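/- Let $k$ be a field of characteristic different from $2$ and $3$, with algebraic closure $\bar k$, and let $S\in k[t]$ be a polynomial of degree $6$ or $5$ without repeated roots in $\bar k$. Let $\mathcal E$ be the elliptic curve $y^2=x^3+S(t)$ over $\bar k(t)$. For $f\in\bar k(t)$ let $\deg f$ denote its degree as a rational map to $\mathbf P^1$, i.e. $\deg f=\max(\deg p,\deg q)$ if $f=p/q$ in lowest terms, so that constants have degree $0$. Define the naive height $h:\mathcal E(\bar k(t))\to\mathbf Q$ by $h(0)=0$ and $h((x,y))=\max(\deg x,\tfrac23\deg y)$. Then there is exactly one quadratic form $\hat h:\mathcal E(\bar k(t))\to\mathbf R$ for which $\hat h-h$ is bounded (the canonical, or Néron–Tate, height), and for every nonzero point $P=(x,y)\in\mathcal E(\bar k(t))$ $$\hat h(P)=\max\bigl(\deg x,\tfrac23\deg y\bigr);$$ that is, the naive and canonical heights on $\mathcal E(\bar k(t))$ are equal. -/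

import Mathlib

open Polynomial

noncomputable section

/-- The degree of a rational function `f ∈ K(t)` considered as a rational map to `ℙ¹`: writing
`f = p / q` in lowest terms, it is `max (deg p) (deg q)`; it is `0` for constant `f`. -/
def ratFuncMapDegree {K : Type*} [Field K] (f : RatFunc K) : ℕ :=
  max f.num.natDegree f.denom.natDegree

/-- The naive height on the `K(t)`-rational points of a Weierstrass curve over `K(t)`: the zero
point has height `0`, and `(x, y)` has height `max (deg x) ((2/3) deg y)`. -/
def naiveHeight {K : Type*} [Field K] (W : WeierstrassCurve.Affine (RatFunc K)) : W.Point → ℝ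
  | .zero => 0
  | .some x y _ => max (ratFuncMapDegree x : ℝ) ((2 / 3 : ℝ) * (ratFuncMapDegree y : ℝ))

/-- A quadratic form on the group of `K(t)`-rational points of a Weierstrass curve over `K(t)` is
the canonical (Néron–Tate) height if it differs from the naive height by a bounded function. -/
def IsCanonicalHeight {K : Type*} [Field K] [DecidableEq (RatFunc K)]
    (W : WeierstrassCurve.Affine (RatFunc K)) (hhat : QuadraticMap ℤ W.Point ℝ) : Prop :=
  ∃ C : ℝ, ∀ P : W.Point, |hhat P - naiveHeight W P| ≤ C

/-- The curve `y² = x³ + S(t)` over `K(t)`, for a polynomial `S` with coefficients in a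
field `k` of which `K` is an extension. -/
def sexticCurve {k : Type*} [Field k] (K : Type*) [Field K] [Algebra k K] (S : k[X]) :
    WeierstrassCurve.Affine (RatFunc K) where
  a₁ := 0
  a₂ := 0
  a₃ := 0
  a₄ := 0
  a₆ := algebraMap K[X] (RatFunc K) (S.map (algebraMap k K))

end

/-!
A pair `{x(P), x(Q)}` of `x`-coordinates is a point of the projective plane with homogeneous
coordinates `(x(P) x(Q) : x(P) + x(Q) : 1)`, and `{x(P + Q), x(P - Q)}` is the image of it under
three quadratic forms. On `y² = x³ + S(t)` these forms have a common zero only where the curve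
degenerates to the cusp `y² = x³` and one of the two points passes through the cusp `(0, 0)`. That
never happens on the affine line, since there `x = y = 0` at a zero of `S` would make it a double
zero. Nor does it happen at `t = ∞`, where `x` and `y` are regarded as having weights `2` and `3`:
the curve degenerates there only if `deg S = 5`, and then a point through the cusp would again
contradict the simplicity of the zero of `S`. Therefore no cancellation occurs in the quadratic
forms, and the naive height, which is the degree of `x` as a section over the projective line with
its weight at infinity, satisfies the parallelogram law exactly, not just up to a bounded error.
So it is itself a quadratic form, and it is the only one at bounded distance from itself because a
bounded quadratic form vanishes.
-/

section Parallelogram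

variable {M A : Type*} [AddCommGroup M] [AddCommGroup A] [IsAddTorsionFree A] {f : M → A}

theorem polar_add_left_of_parallelogram
    (hf : ∀ x y, f (x + y) + f (x - y) = 2 • f x + 2 • f y) (x y z : M) :
    QuadraticMap.polar f (x + y) z = QuadraticMap.polar f x z + QuadraticMap.polar f y z := by
  have h₁ := hf (x + z) y
  have h₂ := hf x (y - z)
  rw [show x + z + y = x + y + z by abel, show x + z - y = x - (y - z) by abel] at h₁
  rw [show x + (y - z) = x + y - z by abel] at h₂
  apply nsmul_right_injective two_ne_zero
  simp only [QuadraticMap.polar]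
  linear_combination (norm := module) h₁ - h₂ + hf (x + y) z - (2 : ℤ) • hf y z

theorem exists_quadraticMap_coe_eq_of_parallelogram
    (hf : ∀ x y, f (x + y) + f (x - y) = 2 • f x + 2 • f y) :
    ∃ q : QuadraticMap ℤ M A, ⇑q = f := by
  have polar_zsmul_left (a : ℤ) (x y : M) :
      QuadraticMap.polar f (a • x) y = a • QuadraticMap.polar f x y :=
    map_zsmul (AddMonoidHom.mk' (QuadraticMap.polar f · y)
      (polar_add_left_of_parallelogram hf · · y)) a x
  have zero : f 0 = 0 := by
    apply nsmul_right_injective two_ne_zero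
    simpa [two_nsmul] using hf 0 0
  have polar_self (x : M) : QuadraticMap.polar f x x = 2 • f x := by
    have h := hf x x
    rw [sub_self, zero, add_zero] at h
    rw [QuadraticMap.polar, h]
    abel
  refine ⟨.ofPolar f (fun a x ↦ nsmul_right_injective two_ne_zero ?_)
    (polar_add_left_of_parallelogram hf) polar_zsmul_left, rfl⟩
  calc 2 • f (a • x) = QuadraticMap.polar f (a • x) (a • x) := (polar_self _).symm
    _ = a • a • QuadraticMap.polar f x x := by
      rw [polar_zsmul_left, QuadraticMap.polar_comm, polar_zsmul_left]
    _ = 2 • (a * a) • f x := by rw [polar_self, smul_smul, smul_comm]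

theorem quadraticMap_eq_zero_of_bounded {E : Type*} [NormedAddCommGroup E] [NormedSpace ℝ E]
    (q : QuadraticMap ℤ M E) {C : ℝ} (hC : ∀ x, ‖q x‖ ≤ C) : q = 0 := by
  ext x
  by_contra hx
  obtain ⟨n, hn⟩ := exists_nat_gt (C / ‖q x‖)
  have hpos : 0 < ‖q x‖ := norm_pos_iff.mpr hx
  have hle : (n : ℝ) ≤ n * n := by exact_mod_cast Nat.le_mul_self n
  have hnorm : ‖q ((n : ℤ) • x)‖ = n * n * ‖q x‖ := by
    rw [QuadraticMap.map_smul, ← Int.cast_smul_eq_zsmul ℝ, norm_smul]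
    simp
  have := hC ((n : ℤ) • x)
  rw [div_lt_iff₀ hpos] at hn
  nlinarith

end Parallelogram

section Unimodular

universe u

/-- A tuple in a commutative ring is unimodular if its entries generate the unit ideal. For tuples
of polynomials over a field this says that they have no common zero on the affine line. -/
def IsUnimodular {R ι : Type*} [CommRing R] (u : ι → R) : Prop :=
  Ideal.span (Set.range u) = ⊤

theorem isUnimodular_iff_forall_comp_ne_zero {R : Type u} {ι : Type*} [CommRing R] {v : ι → R} :
    IsUnimodular v ↔ ∀ (F : Type u) [Field F] (φ : R →+* F), φ ∘ v ≠ 0 := by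
  constructor
  · intro hv F _ φ hφ
    have hle : Ideal.span (Set.range v) ≤ RingHom.ker φ := by
      rw [Ideal.span_le]
      rintro _ ⟨i, rfl⟩
      exact congrFun hφ i
    exact RingHom.ker_ne_top φ (top_le_iff.mp (hv ▸ hle))
  · intro h
    by_contra hv
    obtain ⟨m, hm, hle⟩ := Ideal.exists_le_maximal _ hv
    let := Ideal.Quotient.field m
    refine h (R ⧸ m) (Ideal.Quotient.mk m) (funext fun i ↦ ?_)
    exact Ideal.Quotient.eq_zero_iff_mem.mpr (hle (Ideal.subset_span ⟨i, rfl⟩))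

variable {R ι : Type*} [CommRing R] {u v : ι → R}

theorem isUnimodular_pair_iff {a b : R} : IsUnimodular ![a, b] ↔ IsCoprime a b := by
  rw [IsUnimodular, Matrix.range_cons_cons_empty, Ideal.span_insert, ← Ideal.isCoprime_iff_sup_eq,
    Ideal.isCoprime_span_singleton_iff]

theorem IsUnimodular.ne_zero [Nontrivial R] (hu : IsUnimodular u) : u ≠ 0 := by
  rintro rfl
  refine top_ne_bot (α := Ideal R) (hu.symm.trans (Ideal.span_eq_bot.mpr ?_))
  rintro _ ⟨i, rfl⟩
  rfl

theorem IsUnimodular.dvd_of_forall_dvd_mul (hu : IsUnimodular u) {g p : R}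
    (h : ∀ i, g ∣ p * u i) : g ∣ p := by
  have hle : Ideal.span (Set.range u) ≤
      Submodule.comap (LinearMap.mulLeft R p) (Ideal.span {g}) := by
    rw [Ideal.span_le]
    rintro _ ⟨i, rfl⟩
    simpa [Ideal.mem_span_singleton] using h i
  have hone : (1 : R) ∈ Ideal.span (Set.range u) := hu ▸ Submodule.mem_top
  simpa [Ideal.mem_span_singleton] using hle hone

theorem IsUnimodular.exists_units_smul_eq [IsDomain R] {F : Type*} [Field F] [Algebra R F]
    [IsFractionRing R F] (hu : IsUnimodular u) (hv : IsUnimodular v) {ρ : F}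
    (h : algebraMap R F ∘ v = ρ • (algebraMap R F ∘ u)) : ∃ c : Rˣ, v = c • u := by
  obtain ⟨n, d, hd, rfl⟩ := IsFractionRing.div_surjective (A := R) ρ
  have hd0 : d ≠ 0 := nonZeroDivisors.ne_zero hd
  have hdF : algebraMap R F d ≠ 0 := by simpa using hd0
  have hcross (i : ι) : d * v i = n * u i := by
    apply IsFractionRing.injective R F
    have hi : algebraMap R F (v i) = algebraMap R F n / algebraMap R F d * algebraMap R F (u i) :=
      congrFun h i
    rw [map_mul, map_mul, hi]
    field_simp
  obtain ⟨c, rfl⟩ : d ∣ n := hu.dvd_of_forall_dvd_mul fun i ↦ ⟨v i, (hcross i).symm⟩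
  have hcu (i : ι) : v i = c * u i := mul_left_cancel₀ hd0 (by rw [hcross, mul_assoc])
  have hc : c ∣ 1 := hv.dvd_of_forall_dvd_mul fun i ↦ by simp [hcu]
  exact ⟨(isUnit_of_dvd_one hc).unit, funext hcu⟩

end Unimodular

section AddSubMap

open WeierstrassCurve.Affine

theorem eval_addSubMap {R : Type*} [CommRing R] (W : WeierstrassCurve R) (x : Fin 3 → R) :
    (fun i ↦ MvPolynomial.eval x (W.addSubMap i)) =
      ![x 0 ^ 2 - W.b₄ * x 0 * x 2 - W.b₆ * x 1 * x 2 - W.b₈ * x 2 ^ 2,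
        2 * x 1 * x 0 + W.b₂ * x 0 * x 2 + W.b₄ * x 1 * x 2 + W.b₆ * x 2 ^ 2,
        x 1 ^ 2 - 4 * x 0 * x 2] := by
  ext i
  fin_cases i <;> simp [WeierstrassCurve.addSubMap]

variable {F : Type*} [Field F] [DecidableEq F] (W : WeierstrassCurve.Affine F)

theorem exists_smul_sym2x_add_self (P : W.Point) :
    ∃ κ : F, κ • (P + P).sym2x 0 = fun i ↦ MvPolynomial.eval (P.sym2x P) (W.addSubMap i) := by
  rw [eval_addSubMap]
  match P with
  | 0 => exact ⟨1, by simp⟩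
  | .some x y h =>
    have heq := (W.equation_iff x y).mp h.1
    by_cases hy : y = W.negY x y
    · rw [Point.add_self_of_Y_eq hy, Point.sym2x_zero_zero, Point.sym2x_some_some]
      refine ⟨x ^ 4 - W.b₄ * x ^ 2 - 2 * W.b₆ * x - W.b₈, ?_⟩
      rw [negY] at hy
      have ht : 2 * (x + x) * (x * x) + W.b₂ * (x * x) + W.b₄ * (x + x) + W.b₆ = 0 := by
        simp only [WeierstrassCurve.b₂, WeierstrassCurve.b₄, WeierstrassCurve.b₆]
        linear_combination (2 * y + W.a₁ * x + W.a₃) * hy - 4 * heq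
      simp only [Matrix.smul_vec3, Matrix.cons_val, smul_eq_mul, mul_zero, mul_one, one_pow]
      exact Matrix.vec3_eq (by ring) ht.symm (by ring)
    · have hy' : y - W.negY x y ≠ 0 := sub_ne_zero.mpr hy
      rw [Point.add_self_of_Y_ne hy, Point.sym2x_some_zero, Point.sym2x_some_some]
      refine ⟨(y - W.negY x y) ^ 2, ?_⟩
      have hs : (y - W.negY x y) ^ 2 * W.addX x x (W.slope x x y y) =
          (x * x) ^ 2 - W.b₄ * (x * x) - W.b₆ * (x + x) - W.b₈ := by
        rw [addX, slope_of_Y_ne rfl hy]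
        simp only [WeierstrassCurve.b₄, WeierstrassCurve.b₆, WeierstrassCurve.b₈]
        field_simp
        rw [negY]
        linear_combination (-W.a₁ ^ 2 - 4 * (W.a₂ + 2 * x)) * heq
      have ht : (y - W.negY x y) ^ 2 =
          2 * (x + x) * (x * x) + W.b₂ * (x * x) + W.b₄ * (x + x) + W.b₆ := by
        simp only [negY, WeierstrassCurve.b₂, WeierstrassCurve.b₄, WeierstrassCurve.b₆]
        linear_combination 4 * heq
      simp only [Matrix.smul_vec3, Matrix.cons_val, smul_eq_mul, mul_one, one_pow]
      exact Matrix.vec3_eq hs ht (by ring)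

variable {W} in
theorem smul_sym2x_add_sub_of_X_ne {x₁ y₁ x₂ y₂ : F} (h₁ : W.Nonsingular x₁ y₁)
    (h₂ : W.Nonsingular x₂ y₂) (hx : x₁ ≠ x₂) :
    (x₁ - x₂) ^ 2 •
        (Point.some x₁ y₁ h₁ + .some x₂ y₂ h₂).sym2x (.some x₁ y₁ h₁ - .some x₂ y₂ h₂) =
      fun i ↦ MvPolynomial.eval (Point.sym2x (.some x₁ y₁ h₁) (.some x₂ y₂ h₂))
        (W.addSubMap i) := by
  have e₁ := (W.equation_iff x₁ y₁).mp h₁.1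
  have e₂ := (W.equation_iff x₂ y₂).mp h₂.1
  have hx' : x₁ - x₂ ≠ 0 := sub_ne_zero.mpr hx
  let ψ₁ := y₁ ^ 2 + W.a₁ * x₁ * y₁ + W.a₃ * y₁
  let ψ₂ := y₂ ^ 2 + W.a₁ * x₂ * y₂ + W.a₃ * y₂
  let g₁ := x₁ ^ 3 + W.a₂ * x₁ ^ 2 + W.a₄ * x₁
  let g₂ := x₂ ^ 3 + W.a₂ * x₂ ^ 2 + W.a₄ * x₂
  let m := W.a₁ * (x₁ - x₂) * (W.a₁ * x₂ + W.a₃)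
  let c := (W.a₂ + x₁ + x₂) * (x₁ - x₂) ^ 2
  have hs : (x₁ - x₂) ^ 2 * (W.addX x₁ x₂ (W.slope x₁ x₂ y₁ y₂) *
        W.addX x₁ x₂ (W.slope x₁ x₂ y₁ (W.negY x₂ y₂))) =
      (x₁ * x₂) ^ 2 - W.b₄ * (x₁ * x₂) - W.b₆ * (x₁ + x₂) - W.b₈ := by
    simp only [addX, negY, slope_of_X_ne hx, WeierstrassCurve.b₄, WeierstrassCurve.b₆,
      WeierstrassCurve.b₈]
    field_simp
    linear_combination (ψ₁ - ψ₂ + g₁ - g₂ + m - 2 * c) * e₁ -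
      (ψ₁ - ψ₂ + g₁ - g₂ + m + W.a₁ ^ 2 * (x₁ - x₂) ^ 2 + 2 * c) * e₂
  have ht : (x₁ - x₂) ^ 2 * (W.addX x₁ x₂ (W.slope x₁ x₂ y₁ y₂) +
        W.addX x₁ x₂ (W.slope x₁ x₂ y₁ (W.negY x₂ y₂))) =
      2 * (x₁ + x₂) * (x₁ * x₂) + W.b₂ * (x₁ * x₂) + W.b₄ * (x₁ + x₂) + W.b₆ := by
    simp only [addX, negY, slope_of_X_ne hx, WeierstrassCurve.b₂, WeierstrassCurve.b₄,
      WeierstrassCurve.b₆]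
    field_simp
    linear_combination 2 * e₁ + 2 * e₂
  rw [eval_addSubMap, sub_eq_add_neg (Point.some x₁ y₁ h₁), Point.neg_some, Point.add_of_X_ne hx,
    Point.add_of_X_ne hx, Point.sym2x_some_some, Point.sym2x_some_some]
  simp only [Matrix.smul_vec3, Matrix.cons_val, smul_eq_mul, mul_one, one_pow]
  exact Matrix.vec3_eq hs ht (by ring)

theorem exists_smul_sym2x_add_sub (P Q : W.Point) :
    ∃ κ : F, κ • (P + Q).sym2x (P - Q) =
      fun i ↦ MvPolynomial.eval (P.sym2x Q) (W.addSubMap i) := by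
  by_cases hPQ : P.xRep = Q.xRep
  · obtain ⟨κ, hκ⟩ := exists_smul_sym2x_add_self W P
    refine ⟨κ, ?_⟩
    rcases Point.eq_or_eq_neg_of_xRep_eq_xRep hPQ with rfl | rfl
    · rw [sub_self, hκ]
    · rw [neg_add_cancel, Point.sym2x_comm, ← Point.sym2x_neg_right (-Q), ← hκ, sub_eq_add_neg]
  match P, Q with
  | 0, 0 => exact absurd rfl hPQ
  | 0, .some x y h => exact ⟨1, by simp [eval_addSubMap, pow_two, two_mul]⟩
  | .some x y h, 0 => exact ⟨1, by simp [eval_addSubMap, pow_two, two_mul]⟩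
  | .some x₁ y₁ h₁, .some x₂ y₂ h₂ =>
    have hx : x₁ ≠ x₂ := by simpa using hPQ
    exact ⟨_, smul_sym2x_add_sub_of_X_ne h₁ h₂ hx⟩

end AddSubMap

section WeightedDegree

variable {R : Type*} [CommRing R]

/-- `f` has degree at most `n`, and `c` is its coefficient of degree `n`, that is, the value at
infinity of `f` as a section of `𝒪(n)` on the projective line. -/
def HasTopCoeff (f : R[X]) (n : ℕ) (c : R) : Prop :=
  f.natDegree ≤ n ∧ f.coeff n = c

namespace HasTopCoeff

variable {f g : R[X]} {m n : ℕ} {c d : R}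

theorem mul (hf : HasTopCoeff f m c) (hg : HasTopCoeff g n d) :
    HasTopCoeff (f * g) (m + n) (c * d) :=
  ⟨natDegree_mul_le_of_le hf.1 hg.1, by
    rw [coeff_mul_add_eq_of_natDegree_le hf.1 hg.1, hf.2, hg.2]⟩

theorem add (hf : HasTopCoeff f n c) (hg : HasTopCoeff g n d) : HasTopCoeff (f + g) n (c + d) :=
  ⟨natDegree_add_le_of_degree_le hf.1 hg.1, by rw [coeff_add, hf.2, hg.2]⟩

theorem sub (hf : HasTopCoeff f n c) (hg : HasTopCoeff g n d) : HasTopCoeff (f - g) n (c - d) :=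
  ⟨(natDegree_sub_le_of_le hf.1 hg.1).trans_eq (max_self n), by rw [coeff_sub, hf.2, hg.2]⟩

theorem ofNat_mul (k : ℕ) [k.AtLeastTwo] (hf : HasTopCoeff f n c) :
    HasTopCoeff (ofNat(k) * f) n (ofNat(k) * c) := by
  simpa using mul (m := 0) (c := ofNat(k)) ⟨(natDegree_ofNat k).le, by simp⟩ hf

theorem of_X_pow_mul {k : ℕ} (hf : HasTopCoeff (X ^ k * f) (n + k) c) : HasTopCoeff f n c := by
  refine ⟨?_, by rw [← hf.2, coeff_X_pow_mul]⟩
  by_cases h0 : f = 0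
  · simp [h0]
  · nontriviality R
    have := hf.1
    rw [natDegree_X_pow_mul k h0] at this
    omega

end HasTopCoeff

variable {ι : Type*} [Fintype ι] {e : ι → ℕ} {u : ι → R[X]}

/-- The least `n` with `deg (u i) + e i ≤ n` whenever `u i ≠ 0`, so that `u` represents sections of
the line bundles `𝒪(n - e i)` on the projective line. -/
noncomputable def weightedDegree (e : ι → ℕ) (u : ι → R[X]) : ℕ :=
  Finset.univ.sup fun i ↦ (X ^ e i * u i).natDegree

/-- The values at infinity of the sections of `𝒪(n - e i)` represented by `u`, where
`n = weightedDegree e u`. -/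
noncomputable def topCoeffs (e : ι → ℕ) (u : ι → R[X]) (i : ι) : R :=
  (X ^ e i * u i).coeff (weightedDegree e u)

theorem hasTopCoeff_topCoeffs (e : ι → ℕ) (u : ι → R[X]) (i : ι) :
    HasTopCoeff (X ^ e i * u i) (weightedDegree e u) (topCoeffs e u i) :=
  ⟨Finset.le_sup (f := fun i ↦ (X ^ e i * u i).natDegree) (Finset.mem_univ i), rfl⟩

theorem weightedDegree_eq_of_hasTopCoeff {n : ℕ} {c : ι → R}
    (h : ∀ i, HasTopCoeff (X ^ e i * u i) n (c i)) (hc : c ≠ 0) : weightedDegree e u = n := by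
  obtain ⟨i, hi⟩ := Function.ne_iff.mp hc
  refine le_antisymm (Finset.sup_le fun i _ ↦ (h i).1) ?_
  exact (le_natDegree_of_ne_zero ((h i).2.trans_ne hi)).trans (hasTopCoeff_topCoeffs e u i).1

theorem topCoeffs_eq_of_hasTopCoeff {n : ℕ} {c : ι → R}
    (h : ∀ i, HasTopCoeff (X ^ e i * u i) n (c i)) (hc : c ≠ 0) : topCoeffs e u = c := by
  ext i
  rw [topCoeffs, weightedDegree_eq_of_hasTopCoeff h hc, (h i).2]

theorem topCoeffs_ne_zero (e : ι → ℕ) (hu : u ≠ 0) : topCoeffs e u ≠ 0 := by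
  obtain ⟨j, hj⟩ := Function.ne_iff.mp hu
  have hj' : X ^ e j * u j ≠ 0 := (monic_X_pow (e j)).mul_right_eq_zero_iff.not.mpr hj
  obtain ⟨i, -, hi⟩ := Finset.exists_mem_eq_sup Finset.univ ⟨j, Finset.mem_univ j⟩
    fun i ↦ (X ^ e i * u i).natDegree
  intro h0
  have coeff_eq_zero (i : ι) : (X ^ e i * u i).coeff (weightedDegree e u) = 0 := congrFun h0 i
  have hi0 : X ^ e i * u i = 0 := by
    rw [← leadingCoeff_eq_zero, leadingCoeff, ← hi]
    exact coeff_eq_zero i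
  have hdeg : weightedDegree e u = 0 := by
    rw [weightedDegree, hi, hi0, natDegree_zero]
  have hjdeg := (hasTopCoeff_topCoeffs e u j).1
  rw [hdeg, Nat.le_zero] at hjdeg
  refine hj' (leadingCoeff_eq_zero.mp ?_)
  rw [leadingCoeff, hjdeg, ← hdeg, coeff_eq_zero j]

theorem weightedDegree_units_smul [IsDomain R] (c : R[X]ˣ) (e : ι → ℕ) (u : ι → R[X]) :
    weightedDegree e (c • u) = weightedDegree e u := by
  have (i : ι) : (X ^ e i * (c • u) i).natDegree = (X ^ e i * u i).natDegree :=
    natDegree_eq_of_degree_eq <| degree_eq_degree_of_associated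
      ⟨c⁻¹, by rw [Pi.smul_apply, Units.smul_def, smul_eq_mul, mul_comm (c : R[X]), ← mul_assoc,
        Units.mul_inv_cancel_right]⟩
  simp only [weightedDegree, this]

end WeightedDegree

section Forms

section Unimodularity

variable {R R' : Type*} [CommRing R] [CommRing R']

/-- The coefficients of the product of two binary linear forms. If `p` and `q` are homogeneous
coordinates of `x₁` and `x₂`, then these are homogeneous coordinates `(x₁ x₂ : x₁ + x₂ : 1)` of the
unordered pair `{x₁, x₂}`, in the order used by `WeierstrassCurve.Affine.Point.sym2x`. -/
def sym2 (p q : Fin 2 → R) : Fin 3 → R :=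
  ![p 0 * q 0, p 0 * q 1 + p 1 * q 0, p 1 * q 1]

/-- The map giving homogeneous coordinates of `{x(P + Q), x(P - Q)}` in terms of those of
`{x(P), x(Q)}` for points on `y² = x³ + B`: the specialization of `WeierstrassCurve.addSubMap` to
this curve. -/
def mordellAddSub (B : R) (x : Fin 3 → R) : Fin 3 → R :=
  ![x 0 ^ 2 - 4 * (B * x 1 * x 2), 2 * (x 1 * x 0) + 4 * (B * x 2 ^ 2), x 1 ^ 2 - 4 * (x 0 * x 2)]

theorem comp_sym2 (φ : R →+* R') (p q : Fin 2 → R) : φ ∘ sym2 p q = sym2 (φ ∘ p) (φ ∘ q) := by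
  ext i
  fin_cases i <;> simp [sym2]

theorem comp_mordellAddSub (φ : R →+* R') (B : R) (x : Fin 3 → R) :
    φ ∘ mordellAddSub B x = mordellAddSub (φ B) (φ ∘ x) := by
  ext i
  fin_cases i <;> simp [mordellAddSub, map_ofNat]

theorem sym2_smul_smul (c d : R) (p q : Fin 2 → R) :
    sym2 (c • p) (d • q) = (c * d) • sym2 p q := by
  simp only [sym2, Matrix.smul_vec3, Pi.smul_apply, smul_eq_mul]
  exact Matrix.vec3_eq (by ring) (by ring) (by ring)

theorem mordellAddSub_smul (B c : R) (x : Fin 3 → R) :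
    mordellAddSub B (c • x) = c ^ 2 • mordellAddSub B x := by
  simp only [mordellAddSub, Matrix.smul_vec3, Pi.smul_apply, smul_eq_mul]
  exact Matrix.vec3_eq (by ring) (by ring) (by ring)

theorem eval_addSubMap_eq_mordellAddSub (B : R) (x : Fin 3 → R) :
    (fun i ↦ MvPolynomial.eval x (WeierstrassCurve.addSubMap ⟨0, 0, 0, 0, B⟩ i)) =
      mordellAddSub B x := by
  simp only [eval_addSubMap, mordellAddSub, WeierstrassCurve.b₂, WeierstrassCurve.b₄,
    WeierstrassCurve.b₆, WeierstrassCurve.b₈]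
  exact Matrix.vec3_eq (by ring) (by ring) (by ring)

theorem sym2_ne_zero [NoZeroDivisors R] {p q : Fin 2 → R} (hp : p ≠ 0) (hq : q ≠ 0) :
    sym2 p q ≠ 0 := by
  intro h
  have h₀ : p 0 * q 0 = 0 := congrFun h 0
  have h₁ : p 0 * q 1 + p 1 * q 0 = 0 := congrFun h 1
  have h₂ : p 1 * q 1 = 0 := congrFun h 2
  simp only [ne_eq, funext_iff, Fin.forall_fin_two, Pi.zero_apply] at hp hq
  rcases mul_eq_zero.mp h₀ with h | h <;> rcases mul_eq_zero.mp h₂ with h' | h' <;> simp_all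

theorem mordellAddSub_ne_zero [IsDomain R] (h2 : (2 : R) ≠ 0) (h3 : (3 : R) ≠ 0) {B : R}
    {x : Fin 3 → R} (hx : x ≠ 0) (hB : B = 0 → x 0 ≠ 0) : mordellAddSub B x ≠ 0 := by
  intro h
  have h₀ : x 0 ^ 2 - 4 * (B * x 1 * x 2) = 0 := congrFun h 0
  have h₁ : 2 * (x 1 * x 0) + 4 * (B * x 2 ^ 2) = 0 := congrFun h 1
  have h₂ : x 1 ^ 2 - 4 * (x 0 * x 2) = 0 := congrFun h 2
  have hB0 : B ≠ 0 := by
    rintro rfl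
    exact hB rfl (by simpa using h₀)
  have h02 : x 0 * x 2 = 0 := by
    have : 2 ^ 2 * 3 ^ 2 * B * (x 0 * x 2) * x 2 = 0 := by
      linear_combination x 0 * h₁ - 2 * x 1 * h₀ - 8 * B * x 2 * h₂
    have := mul_eq_zero.mp this
    simp_all
  have hx1 : x 1 = 0 := by simpa [h02] using h₂
  have hx0 : x 0 = 0 := by simpa [hx1] using h₀
  have hx2 : x 2 = 0 := by
    have : 2 ^ 2 * B * x 2 ^ 2 = 0 := by linear_combination h₁ - 2 * x 1 * hx0
    simpa [h2, hB0] using this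
  exact hx (funext fun i ↦ by fin_cases i <;> assumption)

theorem IsUnimodular.sym2 {p q : Fin 2 → R} (hp : IsUnimodular p) (hq : IsUnimodular q) :
    IsUnimodular (sym2 p q) := by
  rw [isUnimodular_iff_forall_comp_ne_zero] at *
  intro F _ φ
  rw [comp_sym2]
  exact sym2_ne_zero (hp F φ) (hq F φ)

theorem IsUnimodular.mordellAddSub (h2 : IsUnit (2 : R)) (h3 : IsUnit (3 : R)) {B : R}
    {x : Fin 3 → R} (hx : IsUnimodular x) (hB : IsCoprime (x 0) B) :
    IsUnimodular (mordellAddSub B x) := by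
  rw [isUnimodular_iff_forall_comp_ne_zero] at *
  intro F _ φ
  rw [comp_mordellAddSub]
  refine mordellAddSub_ne_zero ?_ ?_ (hx F φ) fun hφB hφx ↦ ?_
  · exact map_ofNat φ 2 ▸ (h2.map φ).ne_zero
  · exact map_ofNat φ 3 ▸ (h3.map φ).ne_zero
  · have hcop := hB.map φ
    rw [hφB, ← Function.comp_apply (f := φ), hφx] at hcop
    exact not_isCoprime_zero_zero hcop

end Unimodularity

section Infinity

variable {R : Type*} [CommRing R]

theorem hasTopCoeff_sym2 (p q : Fin 2 → R[X]) (i : Fin 3) :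
    HasTopCoeff (X ^ ![0, 2, 4] i * sym2 p q i)
      (weightedDegree ![0, 2] p + weightedDegree ![0, 2] q)
      (sym2 (topCoeffs ![0, 2] p) (topCoeffs ![0, 2] q) i) := by
  have hp := hasTopCoeff_topCoeffs ![0, 2] p
  have hq := hasTopCoeff_topCoeffs ![0, 2] q
  generalize weightedDegree ![0, 2] p = m, topCoeffs ![0, 2] p = c at hp
  generalize weightedDegree ![0, 2] q = n, topCoeffs ![0, 2] q = d at hq
  fin_cases i
  · change HasTopCoeff (X ^ 0 * (p 0 * q 0)) (m + n) (c 0 * d 0)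
    convert (hp 0).mul (hq 0) using 1
    simp only [Matrix.cons_val]
    ring
  · change HasTopCoeff (X ^ 2 * (p 0 * q 1 + p 1 * q 0)) (m + n) (c 0 * d 1 + c 1 * d 0)
    convert ((hp 0).mul (hq 1)).add ((hp 1).mul (hq 0)) using 1
    simp only [Matrix.cons_val]
    ring
  · change HasTopCoeff (X ^ 4 * (p 1 * q 1)) (m + n) (c 1 * d 1)
    convert (hp 1).mul (hq 1) using 1
    simp only [Matrix.cons_val]
    ring

theorem weightedDegree_sym2 [NoZeroDivisors R] {p q : Fin 2 → R[X]} (hp : p ≠ 0) (hq : q ≠ 0) :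
    weightedDegree ![0, 2, 4] (sym2 p q) =
      weightedDegree ![0, 2] p + weightedDegree ![0, 2] q :=
  weightedDegree_eq_of_hasTopCoeff (hasTopCoeff_sym2 p q)
    (sym2_ne_zero (topCoeffs_ne_zero _ hp) (topCoeffs_ne_zero _ hq))

theorem topCoeffs_sym2 [NoZeroDivisors R] {p q : Fin 2 → R[X]} (hp : p ≠ 0)
    (hq : q ≠ 0) :
    topCoeffs ![0, 2, 4] (sym2 p q) = sym2 (topCoeffs ![0, 2] p) (topCoeffs ![0, 2] q) :=
  topCoeffs_eq_of_hasTopCoeff (hasTopCoeff_sym2 p q)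
    (sym2_ne_zero (topCoeffs_ne_zero _ hp) (topCoeffs_ne_zero _ hq))

theorem hasTopCoeff_mordellAddSub {B : R[X]} (hB : B.natDegree ≤ 6) (u : Fin 3 → R[X])
    (i : Fin 3) :
    HasTopCoeff (X ^ ![0, 2, 4] i * mordellAddSub B u i) (2 * weightedDegree ![0, 2, 4] u)
      (mordellAddSub (B.coeff 6) (topCoeffs ![0, 2, 4] u) i) := by
  have hB : HasTopCoeff B 6 (B.coeff 6) := ⟨hB, rfl⟩
  have hu := hasTopCoeff_topCoeffs ![0, 2, 4] u
  generalize weightedDegree ![0, 2, 4] u = n, topCoeffs ![0, 2, 4] u = c at hu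
  generalize B.coeff 6 = b at hB
  have h₀ : HasTopCoeff (u 0) n (c 0) := by simpa using hu 0
  have h₁ : HasTopCoeff (X ^ 2 * u 1) n (c 1) := hu 1
  have h₂ : HasTopCoeff (X ^ 4 * u 2) n (c 2) := hu 2
  have h₁₂ : HasTopCoeff (B * u 1 * u 2) (n + n) (b * c 1 * c 2) :=
    .of_X_pow_mul (k := 6) (by convert (hB.mul h₁).mul h₂ using 1 <;> ring)
  have h₂₂ : HasTopCoeff (X ^ 2 * (B * u 2 ^ 2)) (n + n) (b * c 2 ^ 2) :=
    .of_X_pow_mul (k := 6) (by convert (hB.mul h₂).mul h₂ using 1 <;> ring)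
  rw [two_mul]
  fin_cases i
  · change HasTopCoeff (X ^ 0 * (u 0 ^ 2 - 4 * (B * u 1 * u 2))) (n + n)
      (c 0 ^ 2 - 4 * (b * c 1 * c 2))
    convert (h₀.mul h₀).sub (h₁₂.ofNat_mul 4) using 1 <;> ring
  · change HasTopCoeff (X ^ 2 * (2 * (u 1 * u 0) + 4 * (B * u 2 ^ 2))) (n + n)
      (2 * (c 1 * c 0) + 4 * (b * c 2 ^ 2))
    convert ((h₁.mul h₀).ofNat_mul 2).add (h₂₂.ofNat_mul 4) using 1
    ring
  · change HasTopCoeff (X ^ 4 * (u 1 ^ 2 - 4 * (u 0 * u 2))) (n + n) (c 1 ^ 2 - 4 * (c 0 * c 2))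
    convert (h₁.mul h₁).sub ((h₀.mul h₂).ofNat_mul 4) using 1 <;> ring

theorem weightedDegree_mordellAddSub [IsDomain R] (h2 : (2 : R) ≠ 0) (h3 : (3 : R) ≠ 0)
    {B : R[X]} (hB : B.natDegree ≤ 6) {u : Fin 3 → R[X]} (hu : u ≠ 0)
    (hu0 : B.coeff 6 = 0 → topCoeffs ![0, 2, 4] u 0 ≠ 0) :
    weightedDegree ![0, 2, 4] (mordellAddSub B u) = 2 * weightedDegree ![0, 2, 4] u :=
  weightedDegree_eq_of_hasTopCoeff (hasTopCoeff_mordellAddSub hB u)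
    (mordellAddSub_ne_zero h2 h3 (topCoeffs_ne_zero _ hu) hu0)

end Infinity

end Forms

section NumDenom

theorem associated_of_mul_eq_mul_of_isCoprime {R : Type*} [CommRing R] [IsDomain R]
    {p q p' q' : R} (h : IsCoprime p q) (h' : IsCoprime p' q') (heq : p * q' = p' * q) :
    Associated p p' ∧ Associated q q' := by
  refine ⟨associated_of_dvd_dvd ?_ ?_, associated_of_dvd_dvd ?_ ?_⟩
  · exact h.dvd_of_dvd_mul_right (heq ▸ dvd_mul_right p q')
  · exact h'.dvd_of_dvd_mul_right (heq ▸ dvd_mul_right p' q)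
  · exact h.symm.dvd_of_dvd_mul_left (heq ▸ dvd_mul_left q p')
  · exact h'.symm.dvd_of_dvd_mul_left (heq ▸ dvd_mul_left q' p)

theorem isCoprime_of_squarefree_of_associated {R : Type*} [CommRing R] [IsDomain R]
    [IsPrincipalIdealRing R] {a B c e : R} (hB : Squarefree B) (hac : IsCoprime a c)
    (he : Associated (e ^ 2) (a ^ 3 + B * c)) : IsCoprime a B := by
  refine isCoprime_of_prime_dvd (fun h ↦ hB.ne_zero h.2) fun p hp hpa hpB ↦ ?_
  have hpe : p ∣ e := hp.dvd_of_dvd_pow <| he.dvd_iff_dvd_right.mpr <|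
    dvd_add (dvd_pow hpa three_ne_zero) (hpB.mul_right c)
  have hpBc : p ^ 2 ∣ B * c := by
    refine (dvd_add_right ?_).mp (he.dvd_iff_dvd_right.mp (pow_dvd_pow_of_dvd hpe 2))
    exact (pow_dvd_pow_of_dvd hpa 2).trans (pow_dvd_pow a (by norm_num))
  have hpc : IsCoprime (p ^ 2) c := (hac.of_isCoprime_of_dvd_left hpa).pow_left
  have hpB : p * p ∣ B := sq p ▸ hpc.dvd_of_dvd_mul_right hpBc
  exact hp.not_isUnit (hB p hpB)

variable {K : Type*} [Field K] {B : K[X]} {x y : RatFunc K}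

theorem associated_num_denom_sq (h : y ^ 2 = x ^ 3 + algebraMap K[X] (RatFunc K) B) :
    Associated (y.num ^ 2) (x.num ^ 3 + B * x.denom ^ 3) ∧
      Associated (y.denom ^ 2) (x.denom ^ 3) := by
  refine associated_of_mul_eq_mul_of_isCoprime y.isCoprime_num_denom.pow
    (x.isCoprime_num_denom.pow.add_mul_right_left B) ?_
  apply RatFunc.algebraMap_injective K
  have hx : algebraMap K[X] (RatFunc K) x.denom ≠ 0 := RatFunc.algebraMap_ne_zero x.denom_ne_zero
  have hy : algebraMap K[X] (RatFunc K) y.denom ≠ 0 := RatFunc.algebraMap_ne_zero y.denom_ne_zero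
  have ex := (div_eq_iff hx).mp x.num_div_denom
  have ey := (div_eq_iff hy).mp y.num_div_denom
  simp only [map_mul, map_add, map_pow, ex, ey]
  linear_combination (algebraMap K[X] (RatFunc K) x.denom ^ 3 *
    algebraMap K[X] (RatFunc K) y.denom ^ 2) * h

theorem isCoprime_num_of_squarefree (hB : Squarefree B)
    (h : y ^ 2 = x ^ 3 + algebraMap K[X] (RatFunc K) B) : IsCoprime x.num B :=
  isCoprime_of_squarefree_of_associated hB x.isCoprime_num_denom.pow_right
    (associated_num_denom_sq h).1

theorem two_mul_natDegree_denom (h : y ^ 2 = x ^ 3 + algebraMap K[X] (RatFunc K) B) :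
    2 * y.denom.natDegree = 3 * x.denom.natDegree := by
  simpa only [natDegree_pow] using
    natDegree_eq_of_degree_eq (degree_eq_degree_of_associated (associated_num_denom_sq h).2)

theorem two_mul_natDegree_num (h : y ^ 2 = x ^ 3 + algebraMap K[X] (RatFunc K) B) :
    2 * y.num.natDegree = (x.num ^ 3 + B * x.denom ^ 3).natDegree := by
  simpa only [natDegree_pow] using
    natDegree_eq_of_degree_eq (degree_eq_degree_of_associated (associated_num_denom_sq h).1)

theorem two_mul_natDegree_num_le (h : y ^ 2 = x ^ 3 + algebraMap K[X] (RatFunc K) B) :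
    2 * y.num.natDegree ≤ max (3 * x.num.natDegree) (B.natDegree + 3 * x.denom.natDegree) := by
  rw [two_mul_natDegree_num h, ← natDegree_pow, ← natDegree_pow]
  exact (natDegree_add_le _ _).trans (max_le_max le_rfl natDegree_mul_le)

theorem two_mul_natDegree_num_of_lt (hB : B ≠ 0)
    (h : y ^ 2 = x ^ 3 + algebraMap K[X] (RatFunc K) B)
    (hlt : 3 * x.num.natDegree < B.natDegree + 3 * x.denom.natDegree) :
    2 * y.num.natDegree = B.natDegree + 3 * x.denom.natDegree := by
  have hBd : (B * x.denom ^ 3).natDegree = B.natDegree + 3 * x.denom.natDegree := by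
    rw [natDegree_mul hB (pow_ne_zero _ x.denom_ne_zero), natDegree_pow]
  rw [two_mul_natDegree_num h, natDegree_add_eq_right_of_natDegree_lt, hBd]
  rwa [hBd, natDegree_pow]

theorem natDegree_denom_add_two_le_natDegree_num (hB : B.natDegree = 5)
    (h : y ^ 2 = x ^ 3 + algebraMap K[X] (RatFunc K) B) :
    x.denom.natDegree + 2 ≤ x.num.natDegree := by
  have hB0 : B ≠ 0 := ne_zero_of_natDegree_gt (n := 4) (by omega)
  have hden := two_mul_natDegree_denom h
  by_contra! hlt
  have hnum := two_mul_natDegree_num_of_lt hB0 h (by omega)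
  omega

theorem max_ratFuncMapDegree_eq (hB : B.natDegree = 5 ∨ B.natDegree = 6)
    (h : y ^ 2 = x ^ 3 + algebraMap K[X] (RatFunc K) B) :
    max (3 * ratFuncMapDegree x) (2 * ratFuncMapDegree y) =
      3 * max x.num.natDegree (x.denom.natDegree + 2) := by
  have hB0 : B ≠ 0 := ne_zero_of_natDegree_gt (n := 4) (by omega)
  have hden := two_mul_natDegree_denom h
  have hle := two_mul_natDegree_num_le h
  have heq := two_mul_natDegree_num_of_lt hB0 h
  unfold ratFuncMapDegree
  omega

end NumDenom

section Points

open WeierstrassCurve.Affine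

variable {K : Type*} [Field K]

/-- The numerator and the denominator in lowest terms of the `x`-coordinate of a point, which are
homogeneous coordinates of `x(P)` without common zeros; the zero point has `x`-coordinate `1 / 0`,
that is, `∞`. -/
noncomputable def xNumDenom {W : WeierstrassCurve.Affine (RatFunc K)} : W.Point → Fin 2 → K[X]
  | .zero => ![1, 0]
  | .some x _ _ => ![x.num, x.denom]

theorem isUnimodular_xNumDenom {W : WeierstrassCurve.Affine (RatFunc K)} (P : W.Point) :
    IsUnimodular (xNumDenom P) :=
  match P with
  | .zero => isUnimodular_pair_iff.mpr isCoprime_one_left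
  | .some x _ _ => isUnimodular_pair_iff.mpr x.isCoprime_num_denom

theorem exists_smul_xRep_eq {W : WeierstrassCurve.Affine (RatFunc K)} (P : W.Point) :
    ∃ d : RatFunc K, d ≠ 0 ∧ algebraMap K[X] (RatFunc K) ∘ xNumDenom P = d • P.xRep := by
  match P with
  | .zero =>
    rw [← Point.zero_def, Point.xRep_zero]
    refine ⟨1, one_ne_zero, funext fun i ↦ ?_⟩
    fin_cases i <;> simp [xNumDenom]
  | .some x y h =>
    have hx : algebraMap K[X] (RatFunc K) x.denom ≠ 0 :=
      RatFunc.algebraMap_ne_zero x.denom_ne_zero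
    refine ⟨algebraMap K[X] (RatFunc K) x.denom, hx, funext fun i ↦ ?_⟩
    fin_cases i
    · simpa [xNumDenom, mul_comm] using (div_eq_iff hx).mp x.num_div_denom
    · simp [xNumDenom]

theorem exists_smul_sym2x_eq {W : WeierstrassCurve.Affine (RatFunc K)} (P Q : W.Point) :
    ∃ d : RatFunc K, d ≠ 0 ∧
      algebraMap K[X] (RatFunc K) ∘ sym2 (xNumDenom P) (xNumDenom Q) = d • P.sym2x Q := by
  obtain ⟨c, hc, hP⟩ := exists_smul_xRep_eq P
  obtain ⟨d, hd, hQ⟩ := exists_smul_xRep_eq Q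
  exact ⟨c * d, mul_ne_zero hc hd, by rw [comp_sym2, hP, hQ, sym2_smul_smul]; rfl⟩

variable {k : Type*} [Field k] [Algebra k K] {S : k[X]}

theorem sexticCurve_equation {x y : RatFunc K} (h : (sexticCurve K S).Nonsingular x y) :
    y ^ 2 = x ^ 3 + algebraMap K[X] (RatFunc K) (S.map (algebraMap k K)) := by
  simpa [sexticCurve] using ((sexticCurve K S).equation_iff x y).mp h.1

theorem isCoprime_xNumDenom_zero (hS : Squarefree (S.map (algebraMap k K)))
    (P : (sexticCurve K S).Point) : IsCoprime (xNumDenom P 0) (S.map (algebraMap k K)) :=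
  match P with
  | .zero => isCoprime_one_left
  | .some _ _ h => isCoprime_num_of_squarefree hS (sexticCurve_equation h)

theorem weightedDegree_num_denom (x : RatFunc K) :
    weightedDegree ![0, 2] ![x.num, x.denom] = max x.num.natDegree (x.denom.natDegree + 2) := by
  simp [weightedDegree, Fin.univ_succ, natDegree_X_pow_mul 2 x.denom_ne_zero]

theorem topCoeffs_xNumDenom_zero_ne_zero (hS : S.natDegree = 5) (P : (sexticCurve K S).Point) :
    topCoeffs ![0, 2] (xNumDenom P) 0 ≠ 0 := by
  match P with
  | .zero => simp [topCoeffs, weightedDegree, xNumDenom, Fin.univ_succ]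
  | .some x y h =>
    have hle := natDegree_denom_add_two_le_natDegree_num
      ((natDegree_map (algebraMap k K)).trans hS) (sexticCurve_equation h)
    have hx : x.num ≠ 0 := ne_zero_of_natDegree_gt (n := 0) (by omega)
    rw [xNumDenom, topCoeffs, weightedDegree_num_denom, max_eq_left hle]
    simpa using hx

theorem naiveHeight_eq_weightedDegree (hS : S.natDegree = 5 ∨ S.natDegree = 6)
    (P : (sexticCurve K S).Point) :
    naiveHeight (sexticCurve K S) P = weightedDegree ![0, 2] (xNumDenom P) := by
  match P with
  | .zero => simp [naiveHeight, weightedDegree, xNumDenom, Fin.univ_succ]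
  | .some x y h =>
    have hmax := max_ratFuncMapDegree_eq (by rwa [natDegree_map]) (sexticCurve_equation h)
    rw [← weightedDegree_num_denom] at hmax
    have hmax : max (3 * ratFuncMapDegree x : ℝ) (2 * ratFuncMapDegree y) =
        3 * weightedDegree ![0, 2] ![x.num, x.denom] := by exact_mod_cast hmax
    calc max (ratFuncMapDegree x : ℝ) (2 / 3 * ratFuncMapDegree y)
      _ = 1 / 3 * max (3 * ratFuncMapDegree x : ℝ) (2 * ratFuncMapDegree y) := by
        rw [mul_max_of_nonneg _ _ (by norm_num)]
        congr 1 <;> ring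
      _ = weightedDegree ![0, 2] ![x.num, x.denom] := by
        rw [hmax]
        ring

variable [DecidableEq (RatFunc K)]

theorem exists_smul_sym2_eq_mordellAddSub (P Q : (sexticCurve K S).Point) :
    ∃ ρ : RatFunc K, algebraMap K[X] (RatFunc K) ∘
        mordellAddSub (S.map (algebraMap k K)) (sym2 (xNumDenom P) (xNumDenom Q)) =
      ρ • (algebraMap K[X] (RatFunc K) ∘ sym2 (xNumDenom (P + Q)) (xNumDenom (P - Q))) := by
  obtain ⟨κ, hκ⟩ := exists_smul_sym2x_add_sub (sexticCurve K S) P Q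
  obtain ⟨d, -, hd⟩ := exists_smul_sym2x_eq P Q
  obtain ⟨d', hd'0, hd'⟩ := exists_smul_sym2x_eq (P + Q) (P - Q)
  have hκ' : κ • (P + Q).sym2x (P - Q) =
      mordellAddSub (algebraMap K[X] (RatFunc K) (S.map (algebraMap k K))) (P.sym2x Q) :=
    hκ.trans (eval_addSubMap_eq_mordellAddSub _ _)
  refine ⟨d ^ 2 * κ / d', ?_⟩
  calc algebraMap K[X] (RatFunc K) ∘
        mordellAddSub (S.map (algebraMap k K)) (sym2 (xNumDenom P) (xNumDenom Q))
    _ = d ^ 2 • κ • (P + Q).sym2x (P - Q) := by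
      rw [comp_mordellAddSub, hd, mordellAddSub_smul, hκ']
    _ = (d ^ 2 * κ / d') • d' • (P + Q).sym2x (P - Q) := by
      rw [smul_smul, smul_smul, div_mul_cancel₀ _ hd'0]
    _ = _ := by rw [hd']

theorem exists_units_smul_sym2_eq_mordellAddSub (h2 : (2 : K) ≠ 0) (h3 : (3 : K) ≠ 0)
    (hS : Squarefree (S.map (algebraMap k K))) (P Q : (sexticCurve K S).Point) :
    ∃ c : K[X]ˣ, mordellAddSub (S.map (algebraMap k K)) (sym2 (xNumDenom P) (xNumDenom Q)) =
      c • sym2 (xNumDenom (P + Q)) (xNumDenom (P - Q)) := by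
  have h2' : IsUnit (2 : K[X]) := map_ofNat (C (R := K)) 2 ▸ h2.isUnit.map C
  have h3' : IsUnit (3 : K[X]) := map_ofNat (C (R := K)) 3 ▸ h3.isUnit.map C
  obtain ⟨ρ, hρ⟩ := exists_smul_sym2_eq_mordellAddSub P Q
  refine IsUnimodular.exists_units_smul_eq ?_ ?_ hρ
  · exact (isUnimodular_xNumDenom _).sym2 (isUnimodular_xNumDenom _)
  · refine ((isUnimodular_xNumDenom P).sym2 (isUnimodular_xNumDenom Q)).mordellAddSub h2' h3' ?_
    exact (isCoprime_xNumDenom_zero hS P).mul_left (isCoprime_xNumDenom_zero hS Q)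

theorem naiveHeight_parallelogram (h2 : (2 : K) ≠ 0) (h3 : (3 : K) ≠ 0)
    (hS : Squarefree (S.map (algebraMap k K))) (hdeg : S.natDegree = 5 ∨ S.natDegree = 6)
    (P Q : (sexticCurve K S).Point) :
    naiveHeight (sexticCurve K S) (P + Q) + naiveHeight (sexticCurve K S) (P - Q) =
      2 • naiveHeight (sexticCurve K S) P + 2 • naiveHeight (sexticCurve K S) Q := by
  have ne_zero (P : (sexticCurve K S).Point) : xNumDenom P ≠ 0 := (isUnimodular_xNumDenom P).ne_zero
  have hB : (S.map (algebraMap k K)).natDegree ≤ 6 := by rw [natDegree_map]; omega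
  have topCoeffs_zero_ne_zero (h6 : (S.map (algebraMap k K)).coeff 6 = 0) :
      topCoeffs ![0, 2, 4] (sym2 (xNumDenom P) (xNumDenom Q)) 0 ≠ 0 := by
    have hS5 : S.natDegree = 5 := hdeg.resolve_right fun hS6 ↦ hS.ne_zero <| by
      rwa [← leadingCoeff_eq_zero, leadingCoeff, natDegree_map, hS6]
    rw [topCoeffs_sym2 (ne_zero P) (ne_zero Q)]
    exact mul_ne_zero (topCoeffs_xNumDenom_zero_ne_zero hS5 P)
      (topCoeffs_xNumDenom_zero_ne_zero hS5 Q)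
  obtain ⟨c, hc⟩ := exists_units_smul_sym2_eq_mordellAddSub h2 h3 hS P Q
  have h := weightedDegree_mordellAddSub h2 h3 hB (sym2_ne_zero (ne_zero P) (ne_zero Q))
    topCoeffs_zero_ne_zero
  rw [hc, weightedDegree_units_smul, weightedDegree_sym2 (ne_zero _) (ne_zero _),
    weightedDegree_sym2 (ne_zero P) (ne_zero Q), mul_add] at h
  simp only [naiveHeight_eq_weightedDegree hdeg, nsmul_eq_mul]
  exact_mod_cast h

end Points

theorem mainTheorem6_general {k K : Type*} [Field k] [Field K] [Algebra k K]
    [DecidableEq (RatFunc K)] (h2 : (2 : k) ≠ 0) (h3 : (3 : k) ≠ 0) (S : k[X])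
    (hS : Squarefree (S.map (algebraMap k K))) (hdeg : S.natDegree = 5 ∨ S.natDegree = 6) :
    (∃! hhat : QuadraticMap ℤ (sexticCurve K S).Point ℝ,
      IsCanonicalHeight (sexticCurve K S) hhat) ∧
    ∀ hhat : QuadraticMap ℤ (sexticCurve K S).Point ℝ,
      IsCanonicalHeight (sexticCurve K S) hhat →
        (∀ (x y : RatFunc K) (hxy : (sexticCurve K S).Nonsingular x y),
          hhat (.some x y hxy) =
            max (ratFuncMapDegree x : ℝ) ((2 / 3 : ℝ) * (ratFuncMapDegree y : ℝ))) ∧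
        ∀ P : (sexticCurve K S).Point, hhat P = naiveHeight (sexticCurve K S) P := by
  have h2' : (2 : K) ≠ 0 := map_ofNat (algebraMap k K) 2 ▸ (_root_.map_ne_zero _).mpr h2
  have h3' : (3 : K) ≠ 0 := map_ofNat (algebraMap k K) 3 ▸ (_root_.map_ne_zero _).mpr h3
  obtain ⟨q, hq⟩ := exists_quadraticMap_coe_eq_of_parallelogram
    (naiveHeight_parallelogram h2' h3' hS hdeg)
  have eq_of_isCanonicalHeight (hhat : QuadraticMap ℤ (sexticCurve K S).Point ℝ) :
      IsCanonicalHeight (sexticCurve K S) hhat → hhat = q := fun ⟨_, hC⟩ ↦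
    sub_eq_zero.mp <| quadraticMap_eq_zero_of_bounded (hhat - q) fun P ↦ by
      rw [sub_apply, hq]
      exact hC P
  refine ⟨⟨q, ⟨0, fun P ↦ by simp [hq]⟩, eq_of_isCanonicalHeight⟩, fun hhat hcan ↦ ?_⟩
  have hnaive (P : (sexticCurve K S).Point) : hhat P = naiveHeight (sexticCurve K S) P := by
    rw [eq_of_isCanonicalHeight hhat hcan, hq]
  exact ⟨fun x y hxy ↦ hnaive (.some x y hxy), hnaive⟩

theorem mainTheorem6 {k K : Type*} [Field k] [Field K] [Algebra k K] [IsAlgClosure k K]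
    [DecidableEq (RatFunc K)] (h2 : (2 : k) ≠ 0) (h3 : (3 : k) ≠ 0)
    (S : k[X]) (hS : S.Separable) (hdeg : S.natDegree = 5 ∨ S.natDegree = 6) :
    (∃! hhat : QuadraticMap ℤ (sexticCurve K S).Point ℝ,
      IsCanonicalHeight (sexticCurve K S) hhat) ∧
    ∀ hhat : QuadraticMap ℤ (sexticCurve K S).Point ℝ,
      IsCanonicalHeight (sexticCurve K S) hhat →
        (∀ (x y : RatFunc K) (hxy : (sexticCurve K S).Nonsingular x y),
          hhat (.some x y hxy) =
            max (ratFuncMapDegree x : ℝ) ((2 / 3 : ℝ) * (ratFuncMapDegree y : ℝ))) ∧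
        ∀ P : (sexticCurve K S).Point, hhat P = naiveHeight (sexticCurve K S) P :=
  mainTheorem6_general h2 h3 S (hS.map (f := algebraMap k K)).squarefree hdeg
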